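/- Let $U$ be an ultrafilter on a set $I$ and, for a set $E$, let ${}^*E=E^I/U$ be its ultrapower; internal functions and $*$-finite sets are the elements of the corresponding ultrapowers. Let $\eta\in{}^*\mathbb N\setminus\mathbb N$ (such an $\eta$ exists exactly when $U$ is countably incomplete, e.g. for every nonprincipal ultrafilter on $\mathbb N$). Let $$\overline{\mathcal R}_\eta=\{x\in{}^*\mathbb R:-\eta\le x<\eta\},$$ let $\mathfrak C_\eta$ be the algebra of internal unions of the intervals $[\tfrac i\eta,\tfrac{i+1}\eta)$ with $i\in{}^*\mathbb Z$, $-\eta^2\le i<\eta^2$, and let $\lambda_\eta$ be the internal counting measure on $\mathfrak C_\eta$ that gives mass $\tfrac1\eta$ to each of these intervals. For an internal function $f$ on $\overline{\mathcal R}_\eta$ that is $\mathfrak C_\eta$-measurable (constant on each of these intervals) and $A\in\mathfrak C_\eta$, the internal integral $\int_A f\,d\lambda_\eta$ is the $*$-finite sum $\tfrac1\eta\sum f(\tfrac i\eta)$ over those $i$ with $[\tfrac i\eta,\tfrac{i+1}\eta)\subseteq A$. Such an $f$ is called $S$-integrable if $\int_{\overline{\mathcal R}_\eta}|f|\,d\lambda_\eta$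 is finite, $\int_A|f|\,d\lambda_\eta\simeq0$ whenever $A\in\mathfrak C_\eta$ and $\lambda_\eta(A)\simeq 0$, and $\int_A|f|\,d\lambda_\eta\simeq0$ whenever $A\in\mathfrak C_\eta$ and $f\simeq0$ everywhere on $A$. Let $(\overline{\mathcal R}_\eta,L(\mathfrak C_\eta),L(\lambda_\eta))$ be the Loeb space: the completion of the Carathéodory extension of ${}^\circ\lambda_\eta$ to $\sigma(\mathfrak C_\eta)$. Let $\mathrm{st}:\overline{\mathcal R}_\eta\to[-\infty,\infty]$ be the standard part map, with value $\pm\infty$ at the positive and negative infinite elements. Let $g:\mathbb R\to\mathbb C$ be a Schwartz function. Put $g_\eta(x)={}^*g\big(\tfrac{[\eta x]}{\eta}\big)$ for $x\in\overline{\mathcal R}_\eta$, where $[\cdot]$ is the integer part, and let $g_\infty:[-\infty,\infty]\to\mathbb C$ be the extension of $g$ with $g_\infty(\pm\infty)=0$. Then: (i) $g_\eta$ is $S$-integrable on $\overline{\mathcal R}_\eta$; (ii) for every $x\in\overline{\mathcal R}_\eta$, $g_\eta(x)$ is finite and ${}^\circ g_\eta(x)=g_\infty(\mathrm{st}(x))$;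 (iii) $g_\infty\circ\mathrm{st}$ is integrable with respect to $L(\lambda_\eta)$, the internal integral $\int_{\overline{\mathcal R}_\eta}g_\eta\,d\lambda_\eta$ is finite, and $${}^\circ\!\int_{\overline{\mathcal R}_\eta}g_\eta\,d\lambda_\eta=\int_{\overline{\mathcal R}_\eta}g_\infty\circ\mathrm{st}\;dL(\lambda_\eta)=\int_{\mathbb R}g\,d\mu,$$ where $\mu$ is Lebesgue measure. -/

import Mathlib

open Filter MeasureTheory
open scoped ENNReal

namespace NSA

universe u v

/-- The nonstandard extension `*E` of a set `E`: the ultrapower `E^ι / U`. An element of `*(ℝ → E)`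
is an internal function, an element of `*(Finset ℤ)` is a `*`-finite set of hyperintegers. -/
abbrev Ext {ι : Type u} (U : Ultrafilter ι) (E : Type v) : Type (max u v) :=
  Germ (U : Filter ι) E

/-- The embedding `E → *E`. -/
def std {ι : Type u} (U : Ultrafilter ι) {E : Type v} (c : E) : Ext U E := Germ.const c

/-- The transfer of the inclusion `ℕ → ℝ`. -/
def natR {ι : Type u} {U : Ultrafilter ι} (n : Ext U ℕ) : Ext U ℝ := Germ.map (fun k : ℕ => (k : ℝ)) n

/-- The transfer of the inclusion `ℤ → ℝ`. -/
def intR {ι : Type u} {U : Ultrafilter ι} (i : Ext U ℤ) : Ext U ℝ := Germ.map (fun k : ℤ => (k : ℝ)) i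

/-- `n ∈ *ℕ \ ℕ`. -/
def IsInfiniteNat {ι : Type u} {U : Ultrafilter ι} (n : Ext U ℕ) : Prop :=
  ∀ k : ℕ, n ≠ std U k

/-- `z ≃ c`, that is, `z` is finite and its standard part `°z` is `c`:
`|z - c| < ε` for every standard `ε > 0`. -/
def IsStdPart {ι : Type u} {U : Ultrafilter ι} {E : Type v} [NormedAddCommGroup E]
    (z : Ext U E) (c : E) : Prop :=
  ∀ ε : ℝ, 0 < ε → Germ.map (fun w : E => ‖w‖) (z - std U c) < std U ε

/-- The standard part of a hyperreal in the extended real line: the usual standard part of a finite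
hyperreal, and `±∞` at the positive and negative infinite hyperreals. -/
noncomputable def extStdPart {ι : Type u} {U : Ultrafilter ι} (x : Ext U ℝ) : EReal :=
  ⨆ (r : ℝ) (_ : std U r ≤ x), (r : EReal)

/-- The value `F(x)` of an internal function `F : *ℝ → *E` at `x`. -/
def evalAt {ι : Type u} {U : Ultrafilter ι} {E : Type v} (F : Ext U (ℝ → E)) (x : Ext U ℝ) :
    Ext U E :=
  Germ.map₂ (fun f t => f t) F x

/-- The internal function `|F|`. -/
noncomputable def absFun {ι : Type u} {U : Ultrafilter ι} (F : Ext U (ℝ → ℂ)) : Ext U (ℝ → ℝ) :=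
  Germ.map (fun f t => ‖f t‖) F

/-- The hyperfinite interval `{τ ∈ *ℝ : -ω/η ≤ τ < ω/η}`. -/
def HyperInterval {ι : Type u} {U : Ultrafilter ι} (ω η : Ext U ℕ) : Type u :=
  {τ : Ext U ℝ // -(natR ω / natR η) ≤ τ ∧ τ < natR ω / natR η}

/-- The `*`-finite set `{i ∈ *ℤ : -ω ≤ i < ω}`. -/
noncomputable def gridIndex {ι : Type u} {U : Ultrafilter ι} (ω : Ext U ℕ) : Ext U (Finset ℤ) :=
  Germ.map (fun m : ℕ => Finset.Ico (-(m : ℤ)) (m : ℤ)) ω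

/-- The union of the intervals `[i/η, (i+1)/η)` over the hyperintegers `i` in the `*`-finite set
`S`, as a subset of the hyperfinite interval. -/
def cellUnion {ι : Type u} {U : Ultrafilter ι} (ω η : Ext U ℕ) (S : Ext U (Finset ℤ)) :
    Set (HyperInterval ω η) :=
  {x | ∃ i : Ext U ℤ, Germ.LiftRel (fun j T => j ∈ T) i S ∧
    intR i / natR η ≤ x.1 ∧ x.1 < (intR i + 1) / natR η}

/-- The algebra `𝔠` of internal unions of the intervals `[i/η, (i+1)/η)`, `-ω ≤ i < ω`.
(An internal subset of the `*`-finite set `{i : -ω ≤ i < ω}` is `*`-finite; on elements of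
`*(Finset ℤ)` the order `≤` is internal inclusion.) -/
def gridAlgebra {ι : Type u} {U : Ultrafilter ι} (ω η : Ext U ℕ) : Set (Set (HyperInterval ω η)) :=
  {A | ∃ S : Ext U (Finset ℤ), S ≤ gridIndex ω ∧ A = cellUnion ω η S}

/-- The internal counting measure `λ`, giving mass `1/η` to each interval `[i/η, (i+1)/η)`: the
value at the union of the intervals indexed by `S`. -/
noncomputable def gridMeasure {ι : Type u} {U : Ultrafilter ι} (η : Ext U ℕ)
    (S : Ext U (Finset ℤ)) : Ext U ℝ :=
  natR (Germ.map Finset.card S) / natR η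

/-- The internal integral `∫_A F dλ = (1/η) ∑_{j ∈ S} F(j/η)` over the union `A` of the
intervals indexed by the `*`-finite set `S`. -/
noncomputable def internalIntegral {ι : Type u} {U : Ultrafilter ι} {E : Type v}
    [AddCommMonoid E] [Module ℝ E] (η : Ext U ℕ) (S : Ext U (Finset ℤ)) (F : Ext U (ℝ → E)) :
    Ext U E :=
  Germ.map₂ (fun (p : ℕ × Finset ℤ) (f : ℝ → E) =>
    (1 / (p.1 : ℝ)) • ∑ j ∈ p.2, f ((j : ℝ) / (p.1 : ℝ))) (Germ.map₂ Prod.mk η S) F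

/-- `S`-integrability of an internal function with respect to the (possibly infinite) internal
measure space `(HyperInterval ω η, 𝔠, λ)`: `F` is `𝔠`-measurable, that is, constant on each
interval `[i/η, (i+1)/η)`; `∫ |F| dλ` is finite; `∫_A |F| dλ ≃ 0` for all `A ∈ 𝔠` with
`λ(A) ≃ 0`; and `∫_A |F| dλ ≃ 0` for all `A ∈ 𝔠` on which `F ≃ 0`. -/
structure SIntegrable {ι : Type u} {U : Ultrafilter ι} (ω η : Ext U ℕ) (F : Ext U (ℝ → ℂ)) :
    Prop where
  measurable : ∀ (i : Ext U ℤ) (x y : HyperInterval ω η),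
    intR i / natR η ≤ x.1 → x.1 < (intR i + 1) / natR η →
    intR i / natR η ≤ y.1 → y.1 < (intR i + 1) / natR η → evalAt F x.1 = evalAt F y.1
  finite : ∃ C : ℝ, internalIntegral η (gridIndex ω) (absFun F) ≤ std U C
  null : ∀ S : Ext U (Finset ℤ), S ≤ gridIndex ω → IsStdPart (gridMeasure η S) 0 →
    IsStdPart (internalIntegral η S (absFun F)) 0
  small : ∀ S : Ext U (Finset ℤ), S ≤ gridIndex ω →
    (∀ x ∈ cellUnion ω η S, IsStdPart (evalAt F x.1) 0) →
    IsStdPart (internalIntegral η S (absFun F)) 0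

/-- The internal function `g_η(x) = *g([ηx]/η)`; see `evalAt_gridSample`. -/
noncomputable def gridSample {ι : Type u} {U : Ultrafilter ι} (g : ℝ → ℂ) (η : Ext U ℕ) :
    Ext U (ℝ → ℂ) :=
  Germ.map (fun (n : ℕ) (t : ℝ) => g ((⌊(n : ℝ) * t⌋ : ℝ) / (n : ℝ))) η

theorem evalAt_gridSample {ι : Type u} {U : Ultrafilter ι} (g : ℝ → ℂ) (η : Ext U ℕ)
    (x : Ext U ℝ) :
    evalAt (gridSample g η) x =
      Germ.map g (intR (Germ.map (fun t : ℝ => ⌊t⌋) (natR η * x)) / natR η) := by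
  induction η, x using Germ.inductionOn₂ with | _ n t => rfl

/-- The extension `g_∞` of `g` to the extended real line by `g_∞(±∞) = 0`. -/
noncomputable def extendZero (g : ℝ → ℂ) (y : EReal) : ℂ :=
  open Classical in if y = ⊤ ∨ y = ⊥ then 0 else g y.toReal

/-- `°λ` on the algebra `𝔠`, and `∞` on all other sets. -/
noncomputable def preLoeb {ι : Type u} {U : Ultrafilter ι} (ω η : Ext U ℕ)
    (A : Set (HyperInterval ω η)) : ℝ≥0∞ :=
  ⨅ (S : Ext U (Finset ℤ)) (_ : S ≤ gridIndex ω) (_ : A = cellUnion ω η S),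
    (extStdPart (gridMeasure η S)).toENNReal

theorem preLoeb_le {ι : Type u} {U : Ultrafilter ι} (ω η : Ext U ℕ) (S : Ext U (Finset ℤ))
    (hS : S ≤ gridIndex ω) :
    preLoeb ω η (cellUnion ω η S) ≤ (extStdPart (gridMeasure η S)).toENNReal :=
  iInf_le_of_le S (iInf_le_of_le hS (iInf_le_of_le rfl le_rfl))

theorem preLoeb_empty {ι : Type u} {U : Ultrafilter ι} (ω η : Ext U ℕ) :
    preLoeb ω η ∅ = 0 := by
  have h1 : cellUnion ω η (std U (∅ : Finset ℤ)) = ∅ := by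
    ext x
    simp only [cellUnion, Set.mem_ofPred_eq, Set.mem_empty_iff_false, iff_false]
    rintro ⟨i, hi, -⟩
    induction i using Germ.inductionOn with
    | _ i =>
      have h2 : ∀ᶠ k in (U : Filter ι), i k ∈ (∅ : Finset ℤ) := hi
      obtain ⟨k, hk⟩ := h2.exists
      exact absurd hk (Finset.notMem_empty _)
  have h2 : std U (∅ : Finset ℤ) ≤ gridIndex ω := by
    induction ω using Germ.inductionOn with
    | _ m => exact Eventually.of_forall (fun k => Finset.empty_subset _)
  have h3 : gridMeasure η (std U (∅ : Finset ℤ)) = 0 := by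
    induction η using Germ.inductionOn with
    | _ n =>
      refine Germ.coe_eq.2 (Eventually.of_forall fun k => ?_)
      simp
  have h4 := preLoeb_le ω η _ h2
  rw [h1, h3] at h4
  refine le_antisymm (h4.trans ?_) bot_le
  rw [le_zero_iff, EReal.toENNReal_eq_zero_iff]
  refine iSup₂_le fun r hr => ?_
  have h5 : r ≤ 0 := Germ.const_le_iff.1 hr
  exact_mod_cast h5

theorem le_extStdPart_add {ι : Type u} {U : Ultrafilter ι} (x y : Ext U ℝ) :
    extStdPart x + extStdPart y ≤ extStdPart (x + y) := by
  refine EReal.add_le_of_forall_lt fun a ha b hb => ?_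
  simp only [extStdPart, lt_iSup_iff] at ha hb
  obtain ⟨r, hr, har⟩ := ha
  obtain ⟨s, hs, hbs⟩ := hb
  have h : std U (r + s) ≤ x + y := by
    induction x, y using Germ.inductionOn₂ with
    | _ x y =>
      have hr' : ∀ᶠ k in (U : Filter ι), r ≤ x k := hr
      have hs' : ∀ᶠ k in (U : Filter ι), s ≤ y k := hs
      have : ∀ᶠ k in (U : Filter ι), r + s ≤ x k + y k := by
        filter_upwards [hr', hs'] with k h1 h2 using add_le_add h1 h2
      exact this
  calc a + b ≤ (r : EReal) + s := add_le_add har.le hbs.le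
    _ = ((r + s : ℝ) : EReal) := (EReal.coe_add r s).symm
    _ ≤ extStdPart (x + y) := le_iSup₂ (f := fun (t : ℝ) (_ : std U t ≤ x + y) => (t : EReal)) _ h

theorem extStdPart_gridMeasure_nonneg {ι : Type u} {U : Ultrafilter ι} (η : Ext U ℕ)
    (S : Ext U (Finset ℤ)) : 0 ≤ extStdPart (gridMeasure η S) := by
  have h : std U (0 : ℝ) ≤ gridMeasure η S := by
    induction η, S using Germ.inductionOn₂ with
    | _ n S =>
      have : ∀ᶠ k in (U : Filter ι), (0 : ℝ) ≤ ((S k).card : ℝ) / (n k : ℝ) :=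
        Eventually.of_forall fun k => by positivity
      exact this
  exact le_iSup₂ (f := fun (t : ℝ) (_ : std U t ≤ gridMeasure η S) => (t : EReal)) 0 h

theorem cell_unique {ι : Type u} {U : Ultrafilter ι} {η : Ext U ℕ} {x : Ext U ℝ} {i j : Ext U ℤ}
    (hi : intR i / natR η ≤ x) (hi' : x < (intR i + 1) / natR η)
    (hj : intR j / natR η ≤ x) (hj' : x < (intR j + 1) / natR η) : i = j := by
  induction η, x using Germ.inductionOn₂ with
  | _ n x =>
  induction i, j using Germ.inductionOn₂ with
  | _ i j =>
  have h1 : ∀ᶠ k in (U : Filter ι), (i k : ℝ) / (n k : ℝ) ≤ x k := hi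
  have h2 : ∀ᶠ k in (U : Filter ι), x k < ((i k : ℝ) + 1) / (n k : ℝ) := Germ.coe_lt.1 hi'
  have h3 : ∀ᶠ k in (U : Filter ι), (j k : ℝ) / (n k : ℝ) ≤ x k := hj
  have h4 : ∀ᶠ k in (U : Filter ι), x k < ((j k : ℝ) + 1) / (n k : ℝ) := Germ.coe_lt.1 hj'
  refine Germ.coe_eq.2 ?_
  filter_upwards [h1, h2, h3, h4] with k h1 h2 h3 h4
  have hn : (0 : ℝ) < n k := by
    rcases Nat.eq_zero_or_pos (n k) with h | h
    · simp only [h, Nat.cast_zero, div_zero] at h1 h2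
      exact absurd h2 (not_lt.2 h1)
    · exact_mod_cast h
  have h5 := (div_lt_div_iff_of_pos_right hn).1 (h1.trans_lt h4)
  have h6 := (div_lt_div_iff_of_pos_right hn).1 (h3.trans_lt h2)
  have h7 : i k < j k + 1 := by exact_mod_cast h5
  have h8 : j k < i k + 1 := by exact_mod_cast h6
  omega

/-- The outer measure induced by `°λ`: the infimum of `∑ °λ(Aₙ)` over countable covers by members
`Aₙ` of `𝔠`. -/
noncomputable def loebOuter {ι : Type u} {U : Ultrafilter ι} (ω η : Ext U ℕ) :
    OuterMeasure (HyperInterval ω η) :=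
  OuterMeasure.ofFunction (preLoeb ω η) (preLoeb_empty ω η)

theorem preLoeb_split {ι : Type u} {U : Ultrafilter ι} (ω η : Ext U ℕ)
    (S T : Ext U (Finset ℤ)) (hT : T ≤ gridIndex ω) :
    preLoeb ω η (cellUnion ω η T ∩ cellUnion ω η S) +
      preLoeb ω η (cellUnion ω η T \ cellUnion ω η S) ≤
      (extStdPart (gridMeasure η T)).toENNReal := by
  have hI : cellUnion ω η T ∩ cellUnion ω η S =
      cellUnion ω η (Germ.map₂ (fun A B => A ∩ B) T S) := by
    ext x
    constructor
    · rintro ⟨⟨i, hi, hi1, hi2⟩, ⟨j, hj, hj1, hj2⟩⟩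
      obtain rfl := cell_unique hi1 hi2 hj1 hj2
      refine ⟨i, ?_, hi1, hi2⟩
      induction i, T, S using Germ.inductionOn₃ with
      | _ i T S =>
        have h1 : ∀ᶠ k in (U : Filter ι), i k ∈ T k := hi
        have h2 : ∀ᶠ k in (U : Filter ι), i k ∈ S k := hj
        have : ∀ᶠ k in (U : Filter ι), i k ∈ T k ∩ S k := by
          filter_upwards [h1, h2] with k h1 h2 using Finset.mem_inter.2 ⟨h1, h2⟩
        exact this
    · rintro ⟨i, hi, hi1, hi2⟩
      induction i, T, S using Germ.inductionOn₃ with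
      | _ i T S =>
        have h : ∀ᶠ k in (U : Filter ι), i k ∈ T k ∩ S k := hi
        have h1 : ∀ᶠ k in (U : Filter ι), i k ∈ T k := h.mono fun k hk => (Finset.mem_inter.1 hk).1
        have h2 : ∀ᶠ k in (U : Filter ι), i k ∈ S k := h.mono fun k hk => (Finset.mem_inter.1 hk).2
        exact ⟨⟨Germ.ofFun i, h1, hi1, hi2⟩, ⟨Germ.ofFun i, h2, hi1, hi2⟩⟩
  have hD : cellUnion ω η T \ cellUnion ω η S =
      cellUnion ω η (Germ.map₂ (fun A B => A \ B) T S) := by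
    ext x
    constructor
    · rintro ⟨⟨i, hi, hi1, hi2⟩, hx⟩
      refine ⟨i, ?_, hi1, hi2⟩
      have hx' : ¬ Germ.LiftRel (fun j T => j ∈ T) i S := fun h => hx ⟨i, h, hi1, hi2⟩
      induction i, T, S using Germ.inductionOn₃ with
      | _ i T S =>
        have h1 : ∀ᶠ k in (U : Filter ι), i k ∈ T k := hi
        have h2 : ∀ᶠ k in (U : Filter ι), i k ∉ S k := Ultrafilter.eventually_not.2 hx'
        have : ∀ᶠ k in (U : Filter ι), i k ∈ T k \ S k := by
          filter_upwards [h1, h2] with k h1 h2 using Finset.mem_sdiff.2 ⟨h1, h2⟩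
        exact this
    · rintro ⟨i, hi, hi1, hi2⟩
      refine ⟨⟨i, ?_, hi1, hi2⟩, ?_⟩
      · induction i, T, S using Germ.inductionOn₃ with
        | _ i T S =>
          have h : ∀ᶠ k in (U : Filter ι), i k ∈ T k \ S k := hi
          exact h.mono fun k hk => (Finset.mem_sdiff.1 hk).1
      · rintro ⟨j, hj, hj1, hj2⟩
        obtain rfl := cell_unique hi1 hi2 hj1 hj2
        induction i, T, S using Germ.inductionOn₃ with
        | _ i T S =>
          have h : ∀ᶠ k in (U : Filter ι), i k ∈ T k \ S k := hi
          have h' : ∀ᶠ k in (U : Filter ι), i k ∈ S k := hj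
          obtain ⟨k, hk, hk'⟩ := (h.and h').exists
          exact (Finset.mem_sdiff.1 hk).2 hk'
  have hIle : Germ.map₂ (fun A B => A ∩ B) T S ≤ gridIndex ω := by
    refine le_trans ?_ hT
    induction T, S using Germ.inductionOn₂ with
    | _ T S => exact Eventually.of_forall fun k => Finset.inter_subset_left
  have hDle : Germ.map₂ (fun A B => A \ B) T S ≤ gridIndex ω := by
    refine le_trans ?_ hT
    induction T, S using Germ.inductionOn₂ with
    | _ T S => exact Eventually.of_forall fun k => Finset.sdiff_subset
  have hadd : gridMeasure η (Germ.map₂ (fun A B => A ∩ B) T S) +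
      gridMeasure η (Germ.map₂ (fun A B => A \ B) T S) = gridMeasure η T := by
    induction η, T, S using Germ.inductionOn₃ with
    | _ n T S =>
      refine Germ.coe_eq.2 (Eventually.of_forall fun k => ?_)
      change ((T k ∩ S k).card : ℝ) / (n k : ℝ) + ((T k \ S k).card : ℝ) / (n k : ℝ) =
        ((T k).card : ℝ) / (n k : ℝ)
      rw [← add_div, ← Nat.cast_add, Finset.card_inter_add_card_sdiff]
  rw [hI, hD]
  calc _ ≤ (extStdPart (gridMeasure η (Germ.map₂ (fun A B => A ∩ B) T S))).toENNReal +
        (extStdPart (gridMeasure η (Germ.map₂ (fun A B => A \ B) T S))).toENNReal :=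
        add_le_add (preLoeb_le ω η _ hIle) (preLoeb_le ω η _ hDle)
    _ = (extStdPart (gridMeasure η (Germ.map₂ (fun A B => A ∩ B) T S)) +
        extStdPart (gridMeasure η (Germ.map₂ (fun A B => A \ B) T S))).toENNReal :=
        (EReal.toENNReal_add (extStdPart_gridMeasure_nonneg _ _)
          (extStdPart_gridMeasure_nonneg _ _)).symm
    _ ≤ _ := EReal.toENNReal_le_toENNReal (hadd ▸ le_extStdPart_add _ _)

theorem generateFrom_le_caratheodory {ι : Type u} {U : Ultrafilter ι} (ω η : Ext U ℕ) :
    MeasurableSpace.generateFrom (gridAlgebra ω η) ≤ (loebOuter ω η).caratheodory := by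
  refine MeasurableSpace.generateFrom_le ?_
  rintro _ ⟨S, -, rfl⟩
  refine OuterMeasure.ofFunction_caratheodory fun t => ?_
  refine le_iInf fun T => le_iInf fun hT => le_iInf fun ht => ?_
  subst ht
  exact preLoeb_split ω η S T hT

/-- The extension of `°λ` to a measure on the `σ`-algebra `σ(𝔠)`. -/
noncomputable def loebBase {ι : Type u} {U : Ultrafilter ι} (ω η : Ext U ℕ) :
    @Measure (HyperInterval ω η) (MeasurableSpace.generateFrom (gridAlgebra ω η)) :=
  @OuterMeasure.toMeasure _ (MeasurableSpace.generateFrom (gridAlgebra ω η)) (loebOuter ω η)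
    (generateFrom_le_caratheodory ω η)

/-- The Loeb `σ`-algebra `L(𝔠)`: the completion of `σ(𝔠)`. -/
noncomputable instance loebSpace {ι : Type u} {U : Ultrafilter ι} (ω η : Ext U ℕ) :
    MeasurableSpace (HyperInterval ω η) :=
  @NullMeasurableSpace.instMeasurableSpace _ (MeasurableSpace.generateFrom (gridAlgebra ω η))
    (loebBase ω η)

/-- The Loeb measure `L(λ)`, the completion of the extension of `°λ` to `σ(𝔠)`. -/
noncomputable def loebMeasure {ι : Type u} {U : Ultrafilter ι} (ω η : Ext U ℕ) :
    Measure (HyperInterval ω η) :=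
  @Measure.completion _ (MeasurableSpace.generateFrom (gridAlgebra ω η)) (loebBase ω η)

end NSA

namespace NSA

open scoped Topology

universe u v

/-! Choose a representative `n` of `η`. Since `η` is infinite, `n k → ∞` along `U`, and `z ≃ c`
means that a representative of `z` tends to `c` along `U` (`isStdPart_coe`). Likewise `st x` is the
limit in `EReal` of a representative of `x`. All claims thus become statements about limits along an
ultrafilter.

Pointwise, rounding to the grid moves a point by at most `1 / n k`, so (ii) is continuity of `g`
together with its vanishing at infinity. For (i), the Riemann sums of `(1 + y ^ 2)⁻¹` are bounded by
`3π` uniformly in mesh and range, and `g` is dominated by the square of a multiple of this function.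

For (iii), both integrals are computed separately and found to be `∫ g`. The internal integral is a
limit of Riemann sums over `[-n, n)`, obtained by dominated convergence (`tendsto_riemannSum`). For
the Loeb integral, countable saturation shows that the Loeb measure of a cell union is its standard
counting measure (`loebMeasure_cellUnion`). Counting grid points then shows that `st` carries the
Loeb measure on the finite points to Lebesgue measure (`map_toReal_stMap_loebMeasure`), and a change
of variables finishes. -/

/-! ### Riemann sums on the grid as integrals of step functions -/

theorem floor_natCast_mul_eq {n : ℕ} (hn : 0 < n) {t : ℝ} {j : ℤ} (h1 : (j : ℝ) / n ≤ t)
    (h2 : t < ((j : ℝ) + 1) / n) : ⌊(n : ℝ) * t⌋ = j := by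
  have hn' : (0 : ℝ) < n := by exact_mod_cast hn
  rw [div_le_iff₀ hn'] at h1
  rw [lt_div_iff₀ hn'] at h2
  exact Int.floor_eq_iff.2 ⟨by linarith, by linarith⟩

theorem floor_natCast_mul_div_le {n : ℕ} (hn : 0 < n) (t : ℝ) : (⌊(n : ℝ) * t⌋ : ℝ) / n ≤ t := by
  have hn' : (0 : ℝ) < n := by exact_mod_cast hn
  rw [div_le_iff₀ hn', mul_comm]
  exact Int.floor_le _

theorem lt_floor_natCast_mul_add_div {n : ℕ} (hn : 0 < n) (t : ℝ) :
    t < ((⌊(n : ℝ) * t⌋ : ℝ) + 1) / n := by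
  have hn' : (0 : ℝ) < n := by exact_mod_cast hn
  rw [lt_div_iff₀ hn', mul_comm]
  exact Int.lt_floor_add_one _

theorem abs_floor_natCast_mul_div_sub_le {n : ℕ} (hn : 0 < n) (t : ℝ) :
    |(⌊(n : ℝ) * t⌋ : ℝ) / n - t| ≤ 1 / n := by
  have h1 := floor_natCast_mul_div_le hn t
  have h2 := lt_floor_natCast_mul_add_div hn t
  rw [add_div] at h2
  rw [abs_le]
  constructor <;> linarith [show (0 : ℝ) ≤ 1 / n by positivity]

theorem integral_floor_cell {E : Type*} [NormedAddCommGroup E] [NormedSpace ℝ E] [CompleteSpace E]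
    (f : ℝ → E) {n : ℕ} (hn : 0 < n) (j : ℤ) :
    IntervalIntegrable (fun t => f ((⌊(n : ℝ) * t⌋ : ℝ) / n)) volume
      ((j : ℝ) / n) (((j : ℝ) + 1) / n) ∧
    ∫ t in ((j : ℝ) / n)..(((j : ℝ) + 1) / n), f ((⌊(n : ℝ) * t⌋ : ℝ) / n) =
      (1 / (n : ℝ)) • f ((j : ℝ) / n) := by
  have hn' : (0 : ℝ) < n := by exact_mod_cast hn
  have hle : (j : ℝ) / n ≤ ((j : ℝ) + 1) / n := by gcongr; linarith
  -- Only the open cell is used: at its right end point the floor has already jumped to `j + 1`.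
  have hEq : Set.EqOn (fun _ => f ((j : ℝ) / n)) (fun t => f ((⌊(n : ℝ) * t⌋ : ℝ) / n))
      (Set.Ioo ((j : ℝ) / n) (((j : ℝ) + 1) / n)) := fun t ht => by
    simp only [floor_natCast_mul_eq hn ht.1.le ht.2]
  constructor
  · rw [intervalIntegrable_iff_integrableOn_Ioo_of_le hle]
    exact IntegrableOn.congr_fun (by simp) hEq measurableSet_Ioo
  · rw [intervalIntegral.integral_of_le hle, integral_Ioc_eq_integral_Ioo,
      ← setIntegral_congr_fun measurableSet_Ioo hEq, ← integral_Ioc_eq_integral_Ioo,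
      ← intervalIntegral.integral_of_le hle, intervalIntegral.integral_const]
    congr 1
    ring

/-- Passing from `N` to `N + 1` adds one cell at each end, so the induction only glues adjacent
intervals. -/
theorem riemannSum_eq_integral_floor {E : Type*} [NormedAddCommGroup E] [NormedSpace ℝ E]
    [CompleteSpace E]
    (f : ℝ → E) {n : ℕ} (hn : 0 < n) (N : ℕ) :
    IntervalIntegrable (fun t => f ((⌊(n : ℝ) * t⌋ : ℝ) / n)) volume
      (-((N : ℝ) / n)) ((N : ℝ) / n) ∧
    (1 / (n : ℝ)) • ∑ j ∈ Finset.Ico (-(N : ℤ)) (N : ℤ), f ((j : ℝ) / n) =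
      ∫ t in (-((N : ℝ) / n))..((N : ℝ) / n), f ((⌊(n : ℝ) * t⌋ : ℝ) / n) := by
  induction N with
  | zero => simp
  | succ N ih =>
    obtain ⟨ih1, ih2⟩ := ih
    have hset : Finset.Ico (-((N + 1 : ℕ) : ℤ)) ((N + 1 : ℕ) : ℤ) =
        insert (-((N : ℤ) + 1)) (insert (N : ℤ) (Finset.Ico (-(N : ℤ)) (N : ℤ))) := by
      ext j
      simp only [Finset.mem_insert, Finset.mem_Ico]
      push_cast
      omega
    obtain ⟨a1, a2⟩ := integral_floor_cell f hn (-((N : ℤ) + 1))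
    obtain ⟨b1, b2⟩ := integral_floor_cell f hn (N : ℤ)
    have e1 : (((-((N : ℤ) + 1) : ℤ) : ℝ)) / n = -(((N + 1 : ℕ) : ℝ) / n) := by push_cast; ring
    have e2 : ((((-((N : ℤ) + 1) : ℤ) : ℝ)) + 1) / n = -((N : ℝ) / n) := by push_cast; ring
    have e3 : ((((N : ℤ) : ℝ)) + 1) / n = ((N + 1 : ℕ) : ℝ) / n := by push_cast; ring
    rw [e2] at a1 a2
    rw [e3] at b1 b2
    have hb0 : ((N : ℤ) : ℝ) = (N : ℝ) := by norm_cast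
    rw [hb0] at b1 b2
    rw [hset, Finset.sum_insert, Finset.sum_insert, smul_add, smul_add, ih2, ← a2, hb0, ← b2, e1]
    · rw [e1] at a1
      refine ⟨(a1.trans ih1).trans b1, ?_⟩
      rw [← intervalIntegral.integral_add_adjacent_intervals (a1.trans ih1) b1,
        ← intervalIntegral.integral_add_adjacent_intervals a1 ih1]
      abel
    · simp
    · simp only [Finset.mem_insert, Finset.mem_Ico]
      omega

theorem inv_one_add_sq_le_of_abs_sub_le_one {y t : ℝ} (h : |y - t| ≤ 1) :
    (1 + y ^ 2)⁻¹ ≤ 3 * (1 + t ^ 2)⁻¹ := by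
  have h1 := abs_le.1 h
  rw [← div_eq_mul_inv, inv_eq_one_div, div_le_div_iff₀ (by positivity) (by positivity)]
  -- From `(2 * y - t) ^ 2 ≥ 0` comes `t ^ 2 ≤ 2 * y ^ 2 + 2 * (y - t) ^ 2 ≤ 2 * y ^ 2 + 2`, hence
  -- the factor 3.
  have h2 : (y - t) ^ 2 ≤ 1 := by nlinarith
  nlinarith [sq_nonneg (2 * y - t), sq_nonneg (y + (y - t))]

/-- The step function lies below `3 * (1 + t ^ 2)⁻¹`, whose integral over the line is `3π`. The
bound depends on neither `n` nor `N`, so it survives the passage to hyperfinite sums. -/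
theorem riemannSum_inv_one_add_sq_le {n : ℕ} (hn : 0 < n) (N : ℕ) :
    (1 / (n : ℝ)) * ∑ j ∈ Finset.Ico (-(N : ℤ)) (N : ℤ), (1 + ((j : ℝ) / n) ^ 2)⁻¹ ≤
      3 * Real.pi := by
  obtain ⟨h1, h2⟩ := riemannSum_eq_integral_floor (fun y : ℝ => (1 + y ^ 2)⁻¹) hn N
  rw [smul_eq_mul] at h2
  have hle : -((N : ℝ) / n) ≤ (N : ℝ) / n := by
    linarith [show (0 : ℝ) ≤ (N : ℝ) / n by positivity]
  have hint : Integrable fun t : ℝ => 3 * (1 + t ^ 2)⁻¹ := integrable_inv_one_add_sq.const_mul 3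
  rw [h2]
  calc _ ≤ ∫ t in (-((N : ℝ) / n))..((N : ℝ) / n), 3 * (1 + t ^ 2)⁻¹ := by
        refine intervalIntegral.integral_mono_on hle h1 hint.intervalIntegrable fun t _ => ?_
        refine inv_one_add_sq_le_of_abs_sub_le_one
          ((abs_floor_natCast_mul_div_sub_le hn t).trans ?_)
        rw [div_le_one (by exact_mod_cast hn)]
        exact_mod_cast hn
    _ ≤ ∫ t : ℝ, 3 * (1 + t ^ 2)⁻¹ := by
        rw [intervalIntegral.integral_of_le hle]
        exact setIntegral_le_integral hint (Eventually.of_forall fun t => by positivity)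
    _ = 3 * Real.pi := by rw [integral_const_mul, integral_univ_inv_one_add_sq]

theorem riemannSum_le_of_forall_le {f : ℝ → ℝ} {K : ℝ} (hK : 0 ≤ K) {n : ℕ} (hn : 0 < n) {N : ℕ}
    {S : Finset ℤ} (hS : S ⊆ Finset.Ico (-(N : ℤ)) (N : ℤ))
    (hf : ∀ j ∈ S, f ((j : ℝ) / n) ≤ K * (1 + ((j : ℝ) / n) ^ 2)⁻¹) :
    (1 / (n : ℝ)) * ∑ j ∈ S, f ((j : ℝ) / n) ≤ K * (3 * Real.pi) := by
  calc (1 / (n : ℝ)) * ∑ j ∈ S, f ((j : ℝ) / n)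
      ≤ (1 / (n : ℝ)) * ∑ j ∈ S, K * (1 + ((j : ℝ) / n) ^ 2)⁻¹ := by
        gcongr with j hj
        exact hf j hj
    _ ≤ (1 / (n : ℝ)) * ∑ j ∈ Finset.Ico (-(N : ℤ)) (N : ℤ), K * (1 + ((j : ℝ) / n) ^ 2)⁻¹ := by
        gcongr
    _ = K * ((1 / (n : ℝ)) * ∑ j ∈ Finset.Ico (-(N : ℤ)) (N : ℤ), (1 + ((j : ℝ) / n) ^ 2)⁻¹) := by
        rw [← Finset.mul_sum]; ring
    _ ≤ K * (3 * Real.pi) := by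
        refine mul_le_mul_of_nonneg_left ?_ hK
        exact riemannSum_inv_one_add_sq_le hn N

theorem tendsto_floor_natCast_mul_div {α : Type*} {l : Filter α} {n : α → ℕ}
    (hn : Tendsto n l atTop) (t : ℝ) :
    Tendsto (fun k => (⌊(n k : ℝ) * t⌋ : ℝ) / n k) l (𝓝 t) := by
  rw [tendsto_iff_norm_sub_tendsto_zero]
  refine squeeze_zero' (Eventually.of_forall fun _ => norm_nonneg _)
    ((hn.eventually_gt_atTop 0).mono fun k hk => abs_floor_natCast_mul_div_sub_le hk t) ?_
  exact tendsto_one_div_atTop_nhds_zero_nat.comp hn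

/-- With `n ^ 2` cells of width `1 / n` on each side, the sum integrates a step function over an
interval from `-n` to `n`. The mesh shrinks while the interval exhausts the line, and `3 * K * (1 +
t ^ 2)⁻¹` dominates. -/
theorem tendsto_riemannSum {g : ℝ → ℂ} (hg : Continuous g) {K : ℝ}
    (hK : ∀ y, ‖g y‖ ≤ K * (1 + y ^ 2)⁻¹) :
    Tendsto (fun n : ℕ => (1 / (n : ℝ)) •
      ∑ j ∈ Finset.Ico (-((n ^ 2 : ℕ) : ℤ)) ((n ^ 2 : ℕ) : ℤ), g ((j : ℝ) / n))
      atTop (𝓝 (∫ t, g t)) := by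
  have hK0 : 0 ≤ K := by simpa using (norm_nonneg _).trans (hK 0)
  have key : Tendsto (fun n : ℕ => ∫ t, (Set.Ioc (-(n : ℝ)) n).indicator
      (fun t => g ((⌊(n : ℝ) * t⌋ : ℝ) / n)) t) atTop (𝓝 (∫ t, g t)) := by
    refine tendsto_integral_filter_of_dominated_convergence
      (fun t => K * (3 * (1 + t ^ 2)⁻¹)) ?_ ?_
      ((integrable_inv_one_add_sq.const_mul 3).const_mul K) ?_
    · refine Eventually.of_forall fun n => ?_
      have : Measurable fun t : ℝ => g ((⌊(n : ℝ) * t⌋ : ℝ) / n) := by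
        have := hg.measurable
        fun_prop
      exact (this.indicator measurableSet_Ioc).aestronglyMeasurable
    · filter_upwards [eventually_gt_atTop 0] with n hn
      refine Eventually.of_forall fun t => (norm_indicator_le_norm_self _ _).trans ((hK _).trans ?_)
      refine mul_le_mul_of_nonneg_left (inv_one_add_sq_le_of_abs_sub_le_one
        ((abs_floor_natCast_mul_div_sub_le hn t).trans ?_)) hK0
      rw [div_le_one (by exact_mod_cast hn)]
      exact_mod_cast hn
    · refine Eventually.of_forall fun t => ?_
      refine ((hg.tendsto t).comp (tendsto_floor_natCast_mul_div tendsto_id t)).congr' ?_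
      -- As soon as `n` exceeds `|t|`, the truncation to `(-n, n]` no longer affects the value at
      -- `t`.
      filter_upwards [eventually_gt_atTop ⌈|t|⌉₊] with n hn
      have h1 := abs_lt.1 ((Nat.lt_of_ceil_lt hn))
      rw [Set.indicator_of_mem (Set.mem_Ioc.2 ⟨h1.1, h1.2.le⟩)]
      rfl
  refine key.congr' ?_
  filter_upwards [eventually_gt_atTop 0] with n hn
  have hn' : (0 : ℝ) < n := by exact_mod_cast hn
  have e : (((n ^ 2 : ℕ) : ℝ)) / n = n := by push_cast; field_simp
  rw [(riemannSum_eq_integral_floor g hn (n ^ 2)).2, integral_indicator measurableSet_Ioc, e,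
    intervalIntegral.integral_of_le (by linarith)]

/-! ### Decay of Schwartz functions and density of grid points -/

/-- The square is there so that the square root of `‖g‖` still has a summable majorant; the third
condition of `S`-integrability uses this. -/
theorem exists_norm_le_sq_inv_one_add_sq (g : SchwartzMap ℝ ℂ) :
    ∃ K : ℝ, 0 ≤ K ∧ ∀ y, ‖g y‖ ≤ (K * (1 + y ^ 2)⁻¹) ^ 2 := by
  obtain ⟨A, hA⟩ := g.decay 0 0
  obtain ⟨B, hB⟩ := g.decay 4 0
  simp only [norm_iteratedFDeriv_zero, pow_zero, one_mul] at hA hB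
  -- The constant comes from `(1 + y ^ 2) ^ 2 ≤ 2 * (1 + y ^ 4)`, that is, `(y ^ 2 - 1) ^ 2 ≥ 0`,
  -- with `A` and `B` bounding `‖g y‖` and `y ^ 4 * ‖g y‖`.
  refine ⟨Real.sqrt (2 * (A + B)), Real.sqrt_nonneg _, fun y => ?_⟩
  have hA0 := (norm_nonneg _).trans (hA.2 0)
  have hB0 : 0 ≤ B := le_trans (by positivity) (hB.2 0)
  rw [mul_pow, Real.sq_sqrt (by positivity), inv_pow, ← div_eq_mul_inv,
    le_div_iff₀ (by positivity)]
  have h1 := hA.2 y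
  have h2 := hB.2 y
  have h3 : ‖y‖ ^ 4 = y ^ 4 := by
    rw [Real.norm_eq_abs]; exact Even.pow_abs (by decide) y
  rw [h3] at h2
  nlinarith [norm_nonneg (g y), mul_nonneg (norm_nonneg (g y)) (sq_nonneg (y ^ 2 - 1))]

theorem tendsto_card_div {α : Type*} {l : Filter α} {n : α → ℕ} (hn : Tendsto n l atTop)
    {a b : ℝ} (hab : a ≤ b) :
    Tendsto (fun k => (((Finset.Ico (-((n k ^ 2 : ℕ) : ℤ)) ((n k ^ 2 : ℕ) : ℤ)).filter
      fun j : ℤ => a ≤ (j : ℝ) / n k ∧ (j : ℝ) / n k < b).card : ℝ) / n k) l (𝓝 (b - a)) := by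
  have hn0 := hn.eventually_gt_atTop 0
  have hc : ∀ c : ℝ, Tendsto (fun k => (⌈c * n k⌉ : ℝ) / n k) l (𝓝 c) := fun c => by
    rw [tendsto_iff_norm_sub_tendsto_zero]
    refine squeeze_zero' (Eventually.of_forall fun _ => norm_nonneg _) ?_
      (tendsto_one_div_atTop_nhds_zero_nat.comp hn)
    filter_upwards [hn0] with k hk
    have hk' : (0 : ℝ) < n k := by exact_mod_cast hk
    have h1 := Int.le_ceil (c * n k)
    have h2 := Int.ceil_lt_add_one (c * n k)
    have h3 : (⌈c * n k⌉ : ℝ) / n k - c = (⌈c * n k⌉ - c * n k) / n k := by field_simp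
    rw [h3, Real.norm_of_nonneg (div_nonneg (by linarith) hk'.le)]
    exact div_le_div_of_nonneg_right (by linarith) hk'.le
  refine ((hc b).sub (hc a)).congr' ?_
  -- Once `n k ≥ max |a| |b|`, the cut-off at `± n k ^ 2` loses no grid point of `[a, b)`.
  filter_upwards [hn0, hn.eventually_ge_atTop ⌈max |a| |b|⌉₊] with k hk hk2
  have hk' : (0 : ℝ) < n k := by exact_mod_cast hk
  have hm := Nat.le_of_ceil_le hk2
  have ha := (neg_le_of_abs_le ((le_max_left _ _).trans hm))
  have hb := (le_of_abs_le ((le_max_right _ _).trans hm))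
  have hset : (Finset.Ico (-((n k ^ 2 : ℕ) : ℤ)) ((n k ^ 2 : ℕ) : ℤ)).filter
      (fun j : ℤ => a ≤ (j : ℝ) / n k ∧ (j : ℝ) / n k < b) =
      Finset.Ico ⌈a * n k⌉ ⌈b * n k⌉ := by
    ext j
    simp only [Finset.mem_filter, Finset.mem_Ico, Int.ceil_le, Int.lt_ceil, le_div_iff₀ hk',
      div_lt_iff₀ hk', and_iff_right_iff_imp]
    rintro ⟨h1, h2⟩
    constructor
    · have : (-((n k ^ 2 : ℕ) : ℤ) : ℝ) ≤ j := by push_cast; nlinarith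
      exact_mod_cast this
    · have : (j : ℝ) < ((n k ^ 2 : ℕ) : ℤ) := by push_cast; nlinarith
      exact_mod_cast this
  have hle : ⌈a * n k⌉ ≤ ⌈b * n k⌉ := Int.ceil_mono (by gcongr)
  have hcard : ((⌈b * n k⌉ - ⌈a * n k⌉).toNat : ℝ) = (⌈b * n k⌉ : ℝ) - ⌈a * n k⌉ := by
    have := Int.toNat_of_nonneg (sub_nonneg.2 hle)
    exact_mod_cast congrArg (Int.cast (R := ℝ)) this
  rw [hset, Int.card_Ico, hcard, sub_div]

/-! ### Representatives and limits along the ultrafilter -/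

section Loeb

variable {ι : Type u} {U : Ultrafilter ι}

theorem IsInfiniteNat.tendsto {n : ι → ℕ} (h : IsInfiniteNat (n : Ext U ℕ)) :
    Tendsto n U atTop := by
  refine tendsto_atTop.2 fun b => ?_
  have h1 : ∀ k : ℕ, ∀ᶠ i in (U : Filter ι), n i ≠ k := fun k =>
    Ultrafilter.eventually_not.2 fun hk => h k (Germ.coe_eq.2 hk)
  have h2 : ∀ᶠ i in (U : Filter ι), ∀ k ∈ Finset.range b, n i ≠ k :=
    (Filter.eventually_all_finset _).2 fun k _ => h1 k
  filter_upwards [h2] with i hi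
  by_contra hb
  exact hi (n i) (Finset.mem_range.2 (not_le.1 hb)) rfl

theorem isStdPart_coe {E : Type v} [NormedAddCommGroup E] {z : ι → E} {c : E} :
    IsStdPart (z : Ext U E) c ↔ Tendsto z U (𝓝 c) := by
  rw [Metric.tendsto_nhds]
  refine forall₂_congr fun ε hε => ?_
  simp only [dist_eq_norm]
  exact Germ.coe_lt (f := fun k => ‖z k - c‖) (g := fun _ => ε)

/-- For every real `r` the ultrafilter decides whether `r ≤ x k`, so the supremum defining the
standard part is a limit. Finite and infinite points need no separate treatment. -/
theorem tendsto_extStdPart (x : ι → ℝ) :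
    Tendsto (fun k => (x k : EReal)) U (𝓝 (extStdPart (x : Ext U ℝ))) := by
  refine tendsto_order.2 ⟨fun a ha => ?_, fun b hb => ?_⟩
  · simp only [extStdPart, lt_iSup_iff] at ha
    obtain ⟨r, hr, har⟩ := ha
    have hr' : ∀ᶠ k in (U : Filter ι), r ≤ x k := hr
    filter_upwards [hr'] with k hk
    exact har.trans_le (EReal.coe_le_coe_iff.2 hk)
  · obtain ⟨s, hs, hsb⟩ := EReal.lt_iff_exists_real_btwn.1 hb
    have h : ¬ ∀ᶠ k in (U : Filter ι), s ≤ x k := fun h =>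
      (not_le.2 hs) (le_iSup₂ (f := fun (t : ℝ) (_ : std U t ≤ (x : Ext U ℝ)) => (t : EReal)) s h)
    filter_upwards [Ultrafilter.eventually_not.2 h] with k hk
    exact (EReal.coe_lt_coe_iff.2 (not_le.1 hk)).trans hsb

theorem extStdPart_eq_of_tendsto {x : ι → ℝ} {y : EReal}
    (h : Tendsto (fun k => (x k : EReal)) U (𝓝 y)) : extStdPart (x : Ext U ℝ) = y :=
  tendsto_nhds_unique (tendsto_extStdPart x) h

theorem tendsto_toENNReal_extStdPart (x : ι → ℝ) :
    Tendsto (fun k => ENNReal.ofReal (x k)) U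
      (𝓝 (extStdPart (x : Ext U ℝ)).toENNReal) :=
  (EReal.continuous_toENNReal.tendsto _).comp (tendsto_extStdPart x)

/-! ### Saturation and the Loeb measure of cell unions -/

theorem exists_mem_sdiff_of_not_le {S T : ι → Finset ℤ}
    (h : ¬ (S : Ext U (Finset ℤ)) ≤ T) :
    ∃ i : ι → ℤ, ∀ᶠ k in (U : Filter ι), i k ∈ S k ∧ i k ∉ T k := by
  have h1 : ∀ᶠ k in (U : Filter ι), ¬ S k ⊆ T k := Ultrafilter.eventually_not.2 h
  have h2 : ∀ k, ∃ i : ℤ, ¬ S k ⊆ T k → i ∈ S k ∧ i ∉ T k := fun k => by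
    by_cases hk : S k ⊆ T k
    · exact ⟨0, fun h => absurd hk h⟩
    · obtain ⟨i, hi, hi'⟩ := Finset.not_subset.1 hk
      exact ⟨i, fun _ => ⟨hi, hi'⟩⟩
  choose i hi using h2
  exact ⟨i, h1.mono fun k hk => hi k hk⟩

/-- The left end point `i/η` of a cell belongs to the hyperfinite interval and to that cell. -/
theorem exists_hyperInterval_of_mem_gridIndex {N n : ι → ℕ} {i : ι → ℤ}
    (hn : ∀ᶠ k in (U : Filter ι), 0 < n k)
    (hi : ∀ᶠ k in (U : Filter ι), i k ∈ Finset.Ico (-(N k : ℤ)) (N k : ℤ)) :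
    ∃ x : HyperInterval (N : Ext U ℕ) (n : Ext U ℕ),
      x.1 = ((fun k => (i k : ℝ) / (n k : ℝ) : ι → ℝ) : Ext U ℝ) ∧
      intR (i : Ext U ℤ) / natR (n : Ext U ℕ) ≤ x.1 ∧
      x.1 < (intR (i : Ext U ℤ) + 1) / natR (n : Ext U ℕ) := by
  refine ⟨⟨((fun k => (i k : ℝ) / (n k : ℝ) : ι → ℝ) : Ext U ℝ), ?_, ?_⟩, rfl, le_rfl, ?_⟩
  · have : ∀ᶠ k in (U : Filter ι), -((N k : ℝ) / (n k : ℝ)) ≤ (i k : ℝ) / (n k : ℝ) := by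
      filter_upwards [hn, hi] with k hk hik
      rw [← neg_div]
      have : -(N k : ℝ) ≤ i k := by exact_mod_cast (Finset.mem_Ico.1 hik).1
      gcongr
    exact this
  · refine Germ.coe_lt.2 ?_
    filter_upwards [hn, hi] with k hk hik
    have h1 : (i k : ℝ) < N k := by exact_mod_cast (Finset.mem_Ico.1 hik).2
    have h2 : (0 : ℝ) < n k := by exact_mod_cast hk
    exact (div_lt_div_iff_of_pos_right h2).2 h1
  · refine Germ.coe_lt.2 ?_
    filter_upwards [hn] with k hk
    have h2 : (0 : ℝ) < n k := by exact_mod_cast hk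
    exact (div_lt_div_iff_of_pos_right h2).2 (lt_add_one (i k : ℝ))

theorem mem_of_mem_cellUnion {ω η : Ext U ℕ} {S : Ext U (Finset ℤ)} {x : HyperInterval ω η}
    {i : Ext U ℤ} (hx : x ∈ cellUnion ω η S) (h1 : intR i / natR η ≤ x.1)
    (h2 : x.1 < (intR i + 1) / natR η) : Germ.LiftRel (fun j T => j ∈ T) i S := by
  obtain ⟨j, hj, hj1, hj2⟩ := hx
  obtain rfl := cell_unique h1 h2 hj1 hj2
  exact hj

/-- The left end point of a cell indexed by `S` but not by `T` would lie in the first union and,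
cells being disjoint, not in the second. Hence a cell union determines its index set, and the
infimum in `preLoeb` has only one value. -/
theorem le_of_cellUnion_subset {N n : ι → ℕ} (hn : ∀ᶠ k in (U : Filter ι), 0 < n k)
    {S T : ι → Finset ℤ} (hS : (S : Ext U (Finset ℤ)) ≤ gridIndex (N : Ext U ℕ))
    (h : cellUnion (N : Ext U ℕ) n S ⊆ cellUnion (N : Ext U ℕ) n T) :
    (S : Ext U (Finset ℤ)) ≤ T := by
  by_contra hST
  obtain ⟨i, hi⟩ := exists_mem_sdiff_of_not_le hST
  have hS' : ∀ᶠ k in (U : Filter ι), S k ⊆ Finset.Ico (-(N k : ℤ)) (N k : ℤ) := hS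
  obtain ⟨x, -, hx1, hx2⟩ := exists_hyperInterval_of_mem_gridIndex (N := N) (i := i) hn
    ((hi.and hS').mono fun k hk => hk.2 hk.1.1)
  have hiS : ∀ᶠ k in (U : Filter ι), i k ∈ S k := hi.mono fun k hk => hk.1
  have hiT : ∀ᶠ k in (U : Filter ι), i k ∈ T k :=
    mem_of_mem_cellUnion (h ⟨(i : Ext U ℤ), hiS, hx1, hx2⟩) hx1 hx2
  obtain ⟨k, hk1, hk2⟩ := (hiT.and hi).exists
  exact hk2.2 hk1

theorem gridMeasure_mono {η : Ext U ℕ} {S T : Ext U (Finset ℤ)} (h : S ≤ T) :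
    gridMeasure η S ≤ gridMeasure η T := by
  induction η, S, T using Germ.inductionOn₃ with
  | _ n S T =>
    have h' : ∀ᶠ k in (U : Filter ι), S k ⊆ T k := h
    have : ∀ᶠ k in (U : Filter ι), ((S k).card : ℝ) / (n k : ℝ) ≤ ((T k).card : ℝ) / (n k : ℝ) := by
      filter_upwards [h'] with k hk
      have := Finset.card_le_card hk
      gcongr
    exact this

theorem extStdPart_mono {x y : Ext U ℝ} (h : x ≤ y) : extStdPart x ≤ extStdPart y :=
  iSup₂_le fun r hr =>
    le_iSup₂ (f := fun (t : ℝ) (_ : std U t ≤ y) => (t : EReal)) r (le_trans hr h)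

theorem preLoeb_cellUnion {N n : ι → ℕ} (hn : ∀ᶠ k in (U : Filter ι), 0 < n k)
    {S : Ext U (Finset ℤ)} (hS : S ≤ gridIndex (N : Ext U ℕ)) :
    preLoeb (N : Ext U ℕ) n (cellUnion (N : Ext U ℕ) n S) =
      (extStdPart (gridMeasure (n : Ext U ℕ) S)).toENNReal := by
  refine le_antisymm (preLoeb_le _ _ S hS) (le_iInf fun T => le_iInf fun hT => le_iInf fun h => ?_)
  refine EReal.toENNReal_le_toENNReal (extStdPart_mono (gridMeasure_mono ?_))
  induction S, T using Germ.inductionOn₂ with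
  | _ S T => exact le_of_cellUnion_subset hn hS h.subset

/-- Countable saturation for covers of a cell union by cell unions. -/
theorem exists_finite_subcover {N n : ι → ℕ} (hn : Tendsto n U atTop)
    {S : ι → Finset ℤ} (hS : (S : Ext U (Finset ℤ)) ≤ gridIndex (N : Ext U ℕ))
    {T : ℕ → ι → Finset ℤ}
    (h : cellUnion (N : Ext U ℕ) n S ⊆ ⋃ m, cellUnion (N : Ext U ℕ) n (T m : Ext U (Finset ℤ))) :
    ∃ M : ℕ, ∀ᶠ k in (U : Filter ι), S k ⊆ (Finset.range M).biUnion fun m => T m k := by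
  classical
  by_contra hcon
  push Not at hcon
  have hcon' : ∀ M : ℕ, ∀ᶠ k in (U : Filter ι),
      ¬ S k ⊆ (Finset.range M).biUnion fun m => T m k := fun M =>
    Ultrafilter.eventually_not.2 (by simpa using hcon M)
  let P : ι → ℕ → Prop := fun k M => ¬ S k ⊆ (Finset.range M).biUnion fun m => T m k
  -- If no finite subfamily covers, let `R k` be the largest `M ≤ n k` for which the first `M` sets
  -- fail to cover `S k`. Every fixed `M` fails for almost all `k` and `n k → ∞`, so `R` eventually
  -- exceeds each fixed `m`. A cell missed by the first `R k` sets therefore lies in none of the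
  -- given cell unions.
  let R : ι → ℕ := fun k => Nat.findGreatest (P k) (n k)
  have hne : ¬ (S : Ext U (Finset ℤ)) ≤
      (fun k => (Finset.range (R k)).biUnion fun m => T m k : ι → Finset ℤ) := by
    refine Ultrafilter.eventually_not.1 ?_
    -- `Nat.findGreatest` returns a value satisfying the predicate only if some candidate does; `M =
    -- 0` serves.
    filter_upwards [hcon' 0] with k hk
    exact Nat.findGreatest_spec (P := P k) (Nat.zero_le _) hk
  obtain ⟨i, hi⟩ := exists_mem_sdiff_of_not_le hne
  have hS' : ∀ᶠ k in (U : Filter ι), S k ⊆ Finset.Ico (-(N k : ℤ)) (N k : ℤ) := hS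
  obtain ⟨x, -, hx1, hx2⟩ := exists_hyperInterval_of_mem_gridIndex (N := N) (n := n) (i := i)
    (hn.eventually_gt_atTop 0) ((hi.and hS').mono fun k hk => hk.2 hk.1.1)
  have hiS : ∀ᶠ k in (U : Filter ι), i k ∈ S k := hi.mono fun k hk => hk.1
  obtain ⟨m, hm⟩ := Set.mem_iUnion.1 (h ⟨(i : Ext U ℤ), hiS, hx1, hx2⟩)
  have hiT : ∀ᶠ k in (U : Filter ι), i k ∈ T m k := mem_of_mem_cellUnion hm hx1 hx2
  obtain ⟨k, hk1, hk2, hk3, hk4⟩ :=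
    (hiT.and (hi.and ((hcon' (m + 1)).and (hn.eventually_ge_atTop (m + 1))))).exists
  have : m + 1 ≤ R k := Nat.le_findGreatest (P := P k) hk4 hk3
  exact hk2.2 (Finset.mem_biUnion.2 ⟨m, Finset.mem_range.2 this, hk1⟩)

theorem toENNReal_gridMeasure_le_tsum {N n : ι → ℕ} (hn : Tendsto n U atTop)
    {S : ι → Finset ℤ} (hS : (S : Ext U (Finset ℤ)) ≤ gridIndex (N : Ext U ℕ))
    {T : ℕ → ι → Finset ℤ}
    (h : cellUnion (N : Ext U ℕ) n S ⊆ ⋃ m, cellUnion (N : Ext U ℕ) n (T m : Ext U (Finset ℤ))) :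
    (extStdPart (gridMeasure (n : Ext U ℕ) (S : Ext U (Finset ℤ)))).toENNReal ≤
      ∑' m, (extStdPart (gridMeasure (n : Ext U ℕ) (T m : Ext U (Finset ℤ)))).toENNReal := by
  obtain ⟨M, hM⟩ := exists_finite_subcover hn hS h
  refine le_trans ?_ (ENNReal.sum_le_tsum (Finset.range M))
  refine le_of_tendsto_of_tendsto
    (tendsto_toENNReal_extStdPart (U := U) fun k => ((S k).card : ℝ) / (n k : ℝ))
    (tendsto_finsetSum (Finset.range M) fun m _ =>
      tendsto_toENNReal_extStdPart (U := U) fun k => ((T m k).card : ℝ) / (n k : ℝ)) ?_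
  filter_upwards [hM] with k hk
  rw [← ENNReal.ofReal_sum_of_nonneg fun _ _ => by positivity, ← Finset.sum_div]
  have h1 := (Finset.card_le_card hk).trans Finset.card_biUnion_le
  have h2 : ((S k).card : ℝ) ≤ ∑ m ∈ Finset.range M, ((T m k).card : ℝ) := by exact_mod_cast h1
  gcongr

theorem loebOuter_cellUnion {N n : ι → ℕ} (hn : Tendsto n U atTop)
    {S : Ext U (Finset ℤ)} (hS : S ≤ gridIndex (N : Ext U ℕ)) :
    loebOuter (N : Ext U ℕ) n (cellUnion (N : Ext U ℕ) n S) =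
      (extStdPart (gridMeasure (n : Ext U ℕ) S)).toENNReal := by
  refine le_antisymm ((OuterMeasure.ofFunction_le _).trans (preLoeb_le _ _ S hS)) ?_
  rw [loebOuter, OuterMeasure.ofFunction_apply]
  refine le_iInf fun t => le_iInf fun ht => ?_
  by_cases hex : ∀ m, ∃ T : ι → Finset ℤ, (T : Ext U (Finset ℤ)) ≤ gridIndex (N : Ext U ℕ) ∧
      t m = cellUnion (N : Ext U ℕ) n (T : Ext U (Finset ℤ))
  · choose T hT hT' using hex
    obtain rfl : t = fun m => cellUnion (N : Ext U ℕ) n (T m : Ext U (Finset ℤ)) := funext hT'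
    simp only [preLoeb_cellUnion (hn.eventually_gt_atTop 0) (hT _)]
    induction S using Germ.inductionOn with
    | _ S => exact toENNReal_gridMeasure_le_tsum hn hS ht
  -- A cover with a member outside the algebra costs `∞`.
  · push Not at hex
    obtain ⟨m, hm⟩ := hex
    have : preLoeb (N : Ext U ℕ) n (t m) = ∞ := by
      refine top_unique (le_iInf fun T => le_iInf fun hT => le_iInf fun h => ?_)
      induction T using Germ.inductionOn with
      | _ T => exact absurd h (hm T hT)
    rw [ENNReal.tsum_eq_top_of_eq_top ⟨m, this⟩]
    exact le_top

theorem measurableSet_cellUnion {ω η : Ext U ℕ} {S : Ext U (Finset ℤ)} (hS : S ≤ gridIndex ω) :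
    MeasurableSet (cellUnion ω η S) :=
  @MeasurableSet.nullMeasurableSet _ (MeasurableSpace.generateFrom (gridAlgebra ω η))
    (loebBase ω η) _ (MeasurableSpace.measurableSet_generateFrom ⟨S, hS, rfl⟩)

theorem loebMeasure_cellUnion {N n : ι → ℕ} (hn : Tendsto n U atTop)
    {S : Ext U (Finset ℤ)} (hS : S ≤ gridIndex (N : Ext U ℕ)) :
    loebMeasure (N : Ext U ℕ) n (cellUnion (N : Ext U ℕ) n S) =
      (extStdPart (gridMeasure (n : Ext U ℕ) S)).toENNReal := by
  rw [← loebOuter_cellUnion hn hS, loebMeasure]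
  refine (@Measure.completion_apply _ (MeasurableSpace.generateFrom (gridAlgebra _ _))
    (loebBase _ _) _).trans ?_
  exact @toMeasure_apply _ (MeasurableSpace.generateFrom (gridAlgebra _ _)) _
    (generateFrom_le_caratheodory _ _) _
    (MeasurableSpace.measurableSet_generateFrom ⟨S, hS, rfl⟩)

/-! ### Standard parts of the sampled function and of its integral -/

theorem tendsto_coe_floor_natCast_mul_div {α : Type*} {l : Filter α} {n : α → ℕ}
    (hn : Tendsto n l atTop) {x : α → ℝ} {y : EReal}
    (h : Tendsto (fun k => (x k : EReal)) l (𝓝 y)) :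
    Tendsto (fun k => (((⌊(n k : ℝ) * x k⌋ : ℝ) / n k : ℝ) : EReal)) l (𝓝 y) := by
  have h0 : Tendsto (fun k => (⌊(n k : ℝ) * x k⌋ : ℝ) / n k - x k) l (𝓝 0) := by
    rw [tendsto_zero_iff_norm_tendsto_zero]
    exact squeeze_zero' (Eventually.of_forall fun _ => norm_nonneg _)
      ((hn.eventually_gt_atTop 0).mono fun k hk => abs_floor_natCast_mul_div_sub_le hk (x k))
      (tendsto_one_div_atTop_nhds_zero_nat.comp hn)
  have h1 : ∀ k, (⌊(n k : ℝ) * x k⌋ : ℝ) / n k =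
      x k + ((⌊(n k : ℝ) * x k⌋ : ℝ) / n k - x k) := fun k => by ring
  refine Tendsto.congr (fun k => congrArg _ (h1 k).symm) ?_
  induction y with
  | bot =>
    rw [EReal.tendsto_coe_nhds_bot_iff] at h ⊢
    exact h.atBot_add h0
  | coe c =>
    rw [EReal.tendsto_coe] at h ⊢
    simpa using h.add h0
  | top =>
    rw [EReal.tendsto_coe_nhds_top_iff] at h ⊢
    exact h.atTop_add h0

theorem tendsto_extendZero {α : Type*} {l : Filter α} {g : ℝ → ℂ} (hg : Continuous g)
    (hg0 : Tendsto g (cocompact ℝ) (𝓝 0)) {x : α → ℝ} {y : EReal}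
    (h : Tendsto (fun k => (x k : EReal)) l (𝓝 y)) :
    Tendsto (fun k => g (x k)) l (𝓝 (extendZero g y)) := by
  induction y with
  | bot =>
    rw [EReal.tendsto_coe_nhds_bot_iff] at h
    simpa [extendZero, Function.comp_def] using (hg0.mono_left atBot_le_cocompact).comp h
  | coe c =>
    rw [EReal.tendsto_coe] at h
    simpa [extendZero, Function.comp_def] using (hg.tendsto c).comp h
  | top =>
    rw [EReal.tendsto_coe_nhds_top_iff] at h
    simpa [extendZero, Function.comp_def] using (hg0.mono_left atTop_le_cocompact).comp h

theorem isStdPart_evalAt_gridSample {n : ι → ℕ} (hn : Tendsto n U atTop) {g : ℝ → ℂ}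
    (hg : Continuous g) (hg0 : Tendsto g (cocompact ℝ) (𝓝 0)) (x : Ext U ℝ) :
    IsStdPart (evalAt (gridSample g (n : Ext U ℕ)) x) (extendZero g (extStdPart x)) := by
  induction x using Germ.inductionOn with
  | _ x =>
  exact isStdPart_coe.2 (tendsto_extendZero hg hg0
    (tendsto_coe_floor_natCast_mul_div hn (tendsto_extStdPart x)))

theorem isStdPart_internalIntegral_gridSample {n : ι → ℕ} (hn : Tendsto n U atTop) {g : ℝ → ℂ}
    (hg : Continuous g) {K : ℝ} (hK : ∀ y, ‖g y‖ ≤ K * (1 + y ^ 2)⁻¹) :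
    IsStdPart (internalIntegral (n : Ext U ℕ) (gridIndex ((fun k => n k ^ 2 : ι → ℕ) : Ext U ℕ))
      (gridSample g (n : Ext U ℕ))) (∫ t, g t) := by
  refine isStdPart_coe.2 (((tendsto_riemannSum hg hK).comp hn).congr' ?_)
  filter_upwards [hn.eventually_gt_atTop 0] with k hk
  -- The sample at a grid point `j / n k` is exactly `g (j / n k)`, because the floor returns `j`.
  have hk' : (n k : ℝ) ≠ 0 := by exact_mod_cast hk.ne'
  change _ = (1 / (n k : ℝ)) • ∑ j ∈ Finset.Ico (-((n k ^ 2 : ℕ) : ℤ)) ((n k ^ 2 : ℕ) : ℤ),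
    g ((⌊(n k : ℝ) * ((j : ℝ) / n k)⌋ : ℝ) / n k)
  simp only [mul_div_cancel₀ _ hk', Int.floor_intCast]
  rfl

/-- A representative of the internal integral of `|g_η|`. -/
theorem internalIntegral_absFun_gridSample {n : ι → ℕ} (hn : ∀ᶠ k in (U : Filter ι), 0 < n k)
    (g : ℝ → ℂ) (S : ι → Finset ℤ) :
    internalIntegral (n : Ext U ℕ) (S : Ext U (Finset ℤ)) (absFun (gridSample g (n : Ext U ℕ))) =
      ((fun k => (1 / (n k : ℝ)) * ∑ j ∈ S k, ‖g ((j : ℝ) / n k)‖ : ι → ℝ) : Ext U ℝ) := by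
  refine Germ.coe_eq.2 ?_
  filter_upwards [hn] with k hk
  have hk' : (n k : ℝ) ≠ 0 := by exact_mod_cast hk.ne'
  change (1 / (n k : ℝ)) • ∑ j ∈ S k, ‖g ((⌊(n k : ℝ) * ((j : ℝ) / n k)⌋ : ℝ) / n k)‖ = _
  simp only [mul_div_cancel₀ _ hk', Int.floor_intCast, smul_eq_mul]

/-! ### `S`-integrability -/

theorem sIntegrable_gridSample {N n : ι → ℕ} (hn : Tendsto n U atTop) {g : ℝ → ℂ} {K : ℝ}
    (hK0 : 0 ≤ K) (hK : ∀ y, ‖g y‖ ≤ (K * (1 + y ^ 2)⁻¹) ^ 2) :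
    SIntegrable (N : Ext U ℕ) (n : Ext U ℕ) (gridSample g (n : Ext U ℕ)) := by
  have hn0 := hn.eventually_gt_atTop 0
  have hone : ∀ y : ℝ, (1 + y ^ 2)⁻¹ ≤ 1 := fun y => inv_le_one_of_one_le₀ (by nlinarith)
  have hK1 : ∀ y, ‖g y‖ ≤ K ^ 2 * (1 + y ^ 2)⁻¹ := fun y => by
    refine (hK y).trans ?_
    rw [mul_pow]
    have : (0 : ℝ) ≤ (1 + y ^ 2)⁻¹ := by positivity
    gcongr
    nlinarith [hone y]
  have hK2 : ∀ y, ‖g y‖ ≤ K ^ 2 := fun y => (hK1 y).trans (by nlinarith [hone y, sq_nonneg K])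
  refine ⟨?_, ⟨K ^ 2 * (3 * Real.pi), ?_⟩, ?_, ?_⟩
  · rintro i ⟨x, hx⟩ ⟨y, hy⟩ h1 h2 h3 h4
    replace h1 : intR i / natR (n : Ext U ℕ) ≤ x := h1
    replace h2 : x < (intR i + 1) / natR (n : Ext U ℕ) := h2
    replace h3 : intR i / natR (n : Ext U ℕ) ≤ y := h3
    replace h4 : y < (intR i + 1) / natR (n : Ext U ℕ) := h4
    change evalAt _ x = evalAt _ y
    clear hx hy
    induction i, x, y using Germ.inductionOn₃ with
    | _ i x y =>
    have h1' : ∀ᶠ k in (U : Filter ι), (i k : ℝ) / (n k : ℝ) ≤ x k := h1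
    have h2' : ∀ᶠ k in (U : Filter ι), x k < ((i k : ℝ) + 1) / (n k : ℝ) := Germ.coe_lt.1 h2
    have h3' : ∀ᶠ k in (U : Filter ι), (i k : ℝ) / (n k : ℝ) ≤ y k := h3
    have h4' : ∀ᶠ k in (U : Filter ι), y k < ((i k : ℝ) + 1) / (n k : ℝ) := Germ.coe_lt.1 h4
    refine Germ.coe_eq.2 ?_
    filter_upwards [h1', h2', h3', h4', hn0] with k h1 h2 h3 h4 hk
    change g ((⌊(n k : ℝ) * x k⌋ : ℝ) / n k) = g ((⌊(n k : ℝ) * y k⌋ : ℝ) / n k)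
    rw [floor_natCast_mul_eq hk h1 h2, floor_natCast_mul_eq hk h3 h4]
  · have : ∀ᶠ k in (U : Filter ι), (1 / (n k : ℝ)) *
        ∑ j ∈ Finset.Ico (-(N k : ℤ)) (N k : ℤ), ‖g ((j : ℝ) / n k)‖ ≤ K ^ 2 * (3 * Real.pi) := by
      filter_upwards [hn0] with k hk
      exact riemannSum_le_of_forall_le (f := fun y => ‖g y‖) (sq_nonneg K) hk subset_rfl
        fun j _ => hK1 _
    exact (internalIntegral_absFun_gridSample hn0 g
      fun k => Finset.Ico (-(N k : ℤ)) (N k : ℤ)).trans_le this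
  · intro S hS h0
    induction S using Germ.inductionOn with
    | _ S =>
    have h0' : Tendsto (fun k => ((S k).card : ℝ) / (n k : ℝ)) U (𝓝 0) := isStdPart_coe.1 h0
    rw [internalIntegral_absFun_gridSample hn0, isStdPart_coe]
    refine squeeze_zero (fun k => by positivity) (fun k => ?_)
      (by simpa using h0'.const_mul (K ^ 2))
    calc (1 / (n k : ℝ)) * ∑ j ∈ S k, ‖g ((j : ℝ) / n k)‖
        ≤ (1 / (n k : ℝ)) * ((S k).card • K ^ 2) := by
          gcongr
          exact Finset.sum_le_card_nsmul _ _ _ fun j _ => hK2 _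
      _ = K ^ 2 * (((S k).card : ℝ) / (n k : ℝ)) := by rw [nsmul_eq_mul]; ring
  · intro S hS h0
    induction S using Germ.inductionOn with
    | _ S =>
    have hS' : ∀ᶠ k in (U : Filter ι), S k ⊆ Finset.Ico (-(N k : ℤ)) (N k : ℤ) := hS
    -- Pointwise smallness on `A` becomes uniform: violating indices chosen for almost all `k` would
    -- form a hyperinteger whose cell lies in `A` and whose left end point has a non-infinitesimal
    -- value.
    have hδ : ∀ δ : ℝ, 0 < δ → ∀ᶠ k in (U : Filter ι), ∀ j ∈ S k, ‖g ((j : ℝ) / n k)‖ < δ := by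
      intro δ hδ
      have hle : (S : Ext U (Finset ℤ)) ≤
          ((fun k => (S k).filter fun j : ℤ => ‖g ((j : ℝ) / n k)‖ < δ : ι → Finset ℤ) :
            Ext U (Finset ℤ)) := by
        by_contra hcon
        obtain ⟨i, hi⟩ := exists_mem_sdiff_of_not_le hcon
        have hiS : ∀ᶠ k in (U : Filter ι), i k ∈ S k := hi.mono fun k hk => hk.1
        obtain ⟨x, hx, hx1, hx2⟩ := exists_hyperInterval_of_mem_gridIndex (N := N) (i := i) hn0
          ((hiS.and hS').mono fun k hk => hk.2 hk.1)
        have h1 := h0 x ⟨(i : Ext U ℤ), hiS, hx1, hx2⟩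
        rw [hx] at h1
        have h2 : Tendsto (fun k => g ((⌊(n k : ℝ) * ((i k : ℝ) / n k)⌋ : ℝ) / n k)) U (𝓝 0) :=
          isStdPart_coe.1 h1
        obtain ⟨k, hk1, hk2, hk3⟩ :=
          ((((tendsto_zero_iff_norm_tendsto_zero.1 h2).eventually_lt_const hδ)).and
            (hi.and hn0)).exists
        have hk' : (n k : ℝ) ≠ 0 := by exact_mod_cast hk3.ne'
        rw [mul_div_cancel₀ _ hk', Int.floor_intCast] at hk1
        exact hk2.2 (Finset.mem_filter.2 ⟨hk2.1, hk1⟩)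
      have hle' : ∀ᶠ k in (U : Filter ι),
          S k ⊆ (S k).filter fun j : ℤ => ‖g ((j : ℝ) / n k)‖ < δ := hle
      exact hle'.mono fun k hk j hj => (Finset.mem_filter.1 (hk hj)).2
    rw [internalIntegral_absFun_gridSample hn0, isStdPart_coe]
    refine tendsto_order.2 ⟨fun a ha => Eventually.of_forall fun k => ha.trans_le (by positivity),
      fun ε hε => ?_⟩
    obtain ⟨δ, hδ0, hδε⟩ : ∃ δ : ℝ, 0 < δ ∧ δ * K * (3 * Real.pi) < ε := by
      have hc : 0 ≤ K * (3 * Real.pi) := by positivity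
      refine ⟨ε / (K * (3 * Real.pi) + 1), by positivity, ?_⟩
      rw [mul_assoc, div_mul_eq_mul_div, div_lt_iff₀ (by positivity)]
      nlinarith
    -- The threshold is `δ ^ 2` because `‖g‖` is bounded by the geometric mean of `δ ^ 2` and `(K *
    -- (1 + y ^ 2)⁻¹) ^ 2`. This gives `δ * K * (1 + y ^ 2)⁻¹`, which is both small and summable.
    filter_upwards [hδ (δ ^ 2) (by positivity), hS', hn0] with k hk hSk hk0
    refine (riemannSum_le_of_forall_le (f := fun y => ‖g y‖) (K := δ * K) (by positivity) hk0 hSk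
      fun j hj => ?_).trans_lt hδε
    rw [mul_assoc]
    refine le_of_sq_le_sq ?_ (by positivity)
    calc ‖g ((j : ℝ) / n k)‖ ^ 2 = ‖g ((j : ℝ) / n k)‖ * ‖g ((j : ℝ) / n k)‖ := sq _
      _ ≤ δ ^ 2 * (K * (1 + ((j : ℝ) / n k) ^ 2)⁻¹) ^ 2 := by
        gcongr
        exacts [(hk j hj).le, hK _]
      _ = _ := (mul_pow _ _ 2).symm

/-! ### The standard part map and Lebesgue measure -/

theorem eventually_floor_mem_gridIndex {N n : ι → ℕ} (hn : ∀ᶠ k in (U : Filter ι), 0 < n k)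
    {x : HyperInterval (N : Ext U ℕ) (n : Ext U ℕ)} {t : ι → ℝ} (hx : x.1 = (t : Ext U ℝ)) :
    ∀ᶠ k in (U : Filter ι), ⌊(n k : ℝ) * t k⌋ ∈ Finset.Ico (-(N k : ℤ)) (N k : ℤ) := by
  have h := x.2
  rw [hx] at h
  have h1 : ∀ᶠ k in (U : Filter ι), -((N k : ℝ) / (n k : ℝ)) ≤ t k := h.1
  have h2 : ∀ᶠ k in (U : Filter ι), t k < (N k : ℝ) / (n k : ℝ) := Germ.coe_lt.1 h.2
  filter_upwards [h1, h2, hn] with k h1 h2 hk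
  have hk' : (0 : ℝ) < n k := by exact_mod_cast hk
  rw [← neg_div, div_le_iff₀ hk'] at h1
  rw [lt_div_iff₀ hk'] at h2
  rw [Finset.mem_Ico, Int.le_floor, Int.floor_lt]
  push_cast
  constructor <;> linarith

theorem mem_cellUnion_iff {N n : ι → ℕ} (hn : ∀ᶠ k in (U : Filter ι), 0 < n k)
    {S : ι → Finset ℤ} {x : HyperInterval (N : Ext U ℕ) (n : Ext U ℕ)} {t : ι → ℝ}
    (hx : x.1 = (t : Ext U ℝ)) :
    x ∈ cellUnion (N : Ext U ℕ) (n : Ext U ℕ) (S : Ext U (Finset ℤ)) ↔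
      ∀ᶠ k in (U : Filter ι), ⌊(n k : ℝ) * t k⌋ ∈ S k := by
  have h1 : intR ((fun k => ⌊(n k : ℝ) * t k⌋ : ι → ℤ) : Ext U ℤ) / natR (n : Ext U ℕ) ≤ x.1 := by
    rw [hx]
    exact hn.mono fun k hk => floor_natCast_mul_div_le hk (t k)
  have h2 : x.1 <
      (intR ((fun k => ⌊(n k : ℝ) * t k⌋ : ι → ℤ) : Ext U ℤ) + 1) / natR (n : Ext U ℕ) := by
    rw [hx]
    exact Germ.coe_lt.2 (hn.mono fun k hk => lt_floor_natCast_mul_add_div hk (t k))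
  exact ⟨fun h => mem_of_mem_cellUnion h h1 h2, fun h =>
    ⟨((fun k => ⌊(n k : ℝ) * t k⌋ : ι → ℤ) : Ext U ℤ), h, h1, h2⟩⟩

open Classical in
/-- The hyperintegers `-ω ≤ j < ω` with `j/η ∈ *s`. -/
noncomputable def gridFilter (N n : ι → ℕ) (s : Set ℝ) (k : ι) : Finset ℤ :=
  (Finset.Ico (-(N k : ℤ)) (N k : ℤ)).filter fun j : ℤ => (j : ℝ) / n k ∈ s

open Classical in
theorem gridFilter_le (N n : ι → ℕ) (s : Set ℝ) :
    (gridFilter N n s : Ext U (Finset ℤ)) ≤ gridIndex (N : Ext U ℕ) :=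
  Eventually.of_forall (p := fun k => gridFilter N n s k ⊆ Finset.Ico (-(N k : ℤ)) (N k : ℤ))
    fun _ => Finset.filter_subset _ _

theorem mem_cellUnion_gridFilter_iff {N n : ι → ℕ} (hn : ∀ᶠ k in (U : Filter ι), 0 < n k)
    {s : Set ℝ} {x : HyperInterval (N : Ext U ℕ) (n : Ext U ℕ)} {t : ι → ℝ}
    (hx : x.1 = (t : Ext U ℝ)) :
    x ∈ cellUnion (N : Ext U ℕ) (n : Ext U ℕ) (gridFilter N n s : Ext U (Finset ℤ)) ↔
      ∀ᶠ k in (U : Filter ι), (⌊(n k : ℝ) * t k⌋ : ℝ) / n k ∈ s := by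
  rw [mem_cellUnion_iff hn hx]
  refine eventually_congr ((eventually_floor_mem_gridIndex hn hx).mono fun k hk => ?_)
  simp [gridFilter, Finset.mem_filter, hk]

theorem tendsto_floor_extStdPart {N n : ι → ℕ} (hn : Tendsto n U atTop)
    {x : HyperInterval (N : Ext U ℕ) (n : Ext U ℕ)} {t : ι → ℝ} (hx : x.1 = (t : Ext U ℝ)) :
    Tendsto (fun k => (((⌊(n k : ℝ) * t k⌋ : ℝ) / n k : ℝ) : EReal)) U (𝓝 (extStdPart x.1)) := by
  rw [hx]
  exact tendsto_coe_floor_natCast_mul_div hn (tendsto_extStdPart t)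

/-- A sequence converging to a point of an open set eventually enters it. With the converse for
closed sets, `extStdPart_mem_of_mem_cellUnion_gridFilter`, this sandwiches preimages under `st`
between cell unions. -/
theorem mem_cellUnion_gridFilter_of_mem_isOpen {N n : ι → ℕ} (hn : Tendsto n U atTop)
    {s : Set ℝ} {O : Set EReal} (hO : IsOpen O) (hs : ∀ t : ℝ, (t : EReal) ∈ O → t ∈ s)
    {x : HyperInterval (N : Ext U ℕ) (n : Ext U ℕ)} (h : extStdPart x.1 ∈ O) :
    x ∈ cellUnion (N : Ext U ℕ) (n : Ext U ℕ) (gridFilter N n s : Ext U (Finset ℤ)) := by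
  obtain ⟨t, ht⟩ := Quotient.exists_rep x.1
  rw [mem_cellUnion_gridFilter_iff (hn.eventually_gt_atTop 0) ht.symm]
  exact ((tendsto_floor_extStdPart hn ht.symm).eventually_mem (hO.mem_nhds h)).mono
    fun k hk => hs _ hk

theorem extStdPart_mem_of_mem_cellUnion_gridFilter {N n : ι → ℕ} (hn : Tendsto n U atTop)
    {s : Set ℝ} {F : Set EReal} (hF : IsClosed F) (hs : ∀ t ∈ s, (t : EReal) ∈ F)
    {x : HyperInterval (N : Ext U ℕ) (n : Ext U ℕ)}
    (h : x ∈ cellUnion (N : Ext U ℕ) (n : Ext U ℕ) (gridFilter N n s : Ext U (Finset ℤ))) :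
    extStdPart x.1 ∈ F := by
  obtain ⟨t, ht⟩ := Quotient.exists_rep x.1
  rw [mem_cellUnion_gridFilter_iff (hn.eventually_gt_atTop 0) ht.symm] at h
  exact hF.mem_of_tendsto (tendsto_floor_extStdPart hn ht.symm) (h.mono fun k hk => hs _ hk)

/-- The standard part map `st` on the hyperfinite interval. -/
noncomputable def stMap (ω η : Ext U ℕ) (x : HyperInterval ω η) : EReal := extStdPart x.1

theorem measurable_stMap {N n : ι → ℕ} (hn : Tendsto n U atTop) :
    Measurable (stMap (N : Ext U ℕ) (n : Ext U ℕ)) := by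
  refine measurable_of_Ioi fun a => ?_
  -- The rational `r` strictly above `a` leaves room for the limit: membership in the cell union
  -- only yields `r ≤ st x`.
  have : stMap (N : Ext U ℕ) (n : Ext U ℕ) ⁻¹' Set.Ioi a =
      ⋃ (r : ℚ) (_ : a < ((r : ℝ) : EReal)),
        cellUnion (N : Ext U ℕ) (n : Ext U ℕ)
          (gridFilter N n (Set.Ici (r : ℝ)) : Ext U (Finset ℤ)) := by
    ext x
    simp only [Set.mem_preimage, Set.mem_Ioi, Set.mem_iUnion, exists_prop]
    constructor
    · intro h
      obtain ⟨r, har, hr⟩ := EReal.lt_iff_exists_rat_btwn.1 h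
      exact ⟨r, har, mem_cellUnion_gridFilter_of_mem_isOpen hn isOpen_Ioi
        (fun t ht => (EReal.coe_lt_coe_iff.1 ht).le) hr⟩
    · rintro ⟨r, har, hx⟩
      exact har.trans_le (extStdPart_mem_of_mem_cellUnion_gridFilter hn isClosed_Ici
        (fun t ht => EReal.coe_le_coe_iff.2 ht) hx)
  rw [this]
  exact MeasurableSet.iUnion fun r => MeasurableSet.iUnion fun _ =>
    measurableSet_cellUnion (gridFilter_le _ _ _)

theorem loebMeasure_cellUnion_Ico {n : ι → ℕ} (hn : Tendsto n U atTop) {a b : ℝ} (hab : a ≤ b) :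
    loebMeasure ((fun k => n k ^ 2 : ι → ℕ) : Ext U ℕ) (n : Ext U ℕ)
      (cellUnion ((fun k => n k ^ 2 : ι → ℕ) : Ext U ℕ) (n : Ext U ℕ)
        (gridFilter (fun k => n k ^ 2) n (Set.Ico a b) : Ext U (Finset ℤ))) =
      ENNReal.ofReal (b - a) := by
  rw [loebMeasure_cellUnion hn (gridFilter_le _ _ _)]
  have h : extStdPart (gridMeasure (n : Ext U ℕ)
      (gridFilter (fun k => n k ^ 2) n (Set.Ico a b) : Ext U (Finset ℤ))) = ((b - a : ℝ) : EReal) :=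
    extStdPart_eq_of_tendsto (EReal.tendsto_coe.2 (by
      refine (tendsto_card_div hn hab).congr fun k => ?_
      change _ = ((gridFilter (fun k => n k ^ 2) n (Set.Ico a b) k).card : ℝ) / (n k : ℝ)
      simp only [gridFilter, Set.mem_Ico]))
  rw [h, EReal.toENNReal_of_ne_top (EReal.coe_ne_top _), EReal.toReal_coe]

theorem loebMeasure_stMap_preimage_Ioo {n : ι → ℕ} (hn : Tendsto n U atTop) (a b : ℝ) :
    loebMeasure ((fun k => n k ^ 2 : ι → ℕ) : Ext U ℕ) (n : Ext U ℕ)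
      (stMap _ _ ⁻¹' Set.Ioo (a : EReal) b) = ENNReal.ofReal (b - a) := by
  rcases le_or_gt b a with hab | hab
  · rw [Set.Ioo_eq_empty (by simpa using hab), Set.preimage_empty, measure_empty,
      ENNReal.ofReal_of_nonpos (by linarith)]
  refine le_antisymm ?_ ?_
  · rw [← loebMeasure_cellUnion_Ico hn hab.le]
    exact measure_mono fun x hx => mem_cellUnion_gridFilter_of_mem_isOpen hn isOpen_Ioo
      (s := Set.Ico a b) (fun t ht => ⟨(EReal.coe_lt_coe_iff.1 ht.1).le, EReal.coe_lt_coe_iff.1 ht.2⟩) hx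
  -- Grid points in `[a + δ, b - δ)` have standard parts in the closed interval, hence strictly
  -- inside `(a, b)`; then `δ → 0`.
  · have ht : Tendsto (fun δ : ℝ => ENNReal.ofReal ((b - δ) - (a + δ))) (𝓝[>] 0)
        (𝓝 (ENNReal.ofReal (b - a))) := by
      have : Continuous fun δ : ℝ => ENNReal.ofReal ((b - δ) - (a + δ)) :=
        ENNReal.continuous_ofReal.comp (by fun_prop)
      simpa using (this.tendsto 0).mono_left nhdsWithin_le_nhds
    refine le_of_tendsto ht ?_
    filter_upwards [Ioo_mem_nhdsGT (show (0 : ℝ) < (b - a) / 2 by linarith)] with δ hδ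
    rw [← loebMeasure_cellUnion_Ico hn (by linarith [hδ.2])]
    refine measure_mono fun x hx => ?_
    have h := extStdPart_mem_of_mem_cellUnion_gridFilter hn
      (isClosed_Icc (a := ((a + δ : ℝ) : EReal)) (b := ((b - δ : ℝ) : EReal)))
      (fun t ht => ⟨EReal.coe_le_coe_iff.2 ht.1, EReal.coe_le_coe_iff.2 ht.2.le⟩) hx
    exact ⟨(EReal.coe_lt_coe_iff.2 (by linarith [hδ.1])).trans_le h.1,
      h.2.trans_lt (EReal.coe_lt_coe_iff.2 (by linarith [hδ.1]))⟩

/-- The standard part map carries the Loeb measure on the finite elements to Lebesgue measure. -/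
theorem map_toReal_stMap_loebMeasure {n : ι → ℕ} (hn : Tendsto n U atTop) :
    ((loebMeasure ((fun k => n k ^ 2 : ι → ℕ) : Ext U ℕ) (n : Ext U ℕ)).restrict
      (stMap _ _ ⁻¹' {⊤, ⊥}ᶜ)).map (fun x => (stMap _ _ x).toReal) =
      (volume : Measure ℝ) := by
  have hm := measurable_stMap (N := fun k => n k ^ 2) hn
  have hr : Measurable fun x => (stMap ((fun k => n k ^ 2 : ι → ℕ) : Ext U ℕ) (n : Ext U ℕ) x).toReal :=
    measurable_ereal_toReal.comp hm
  -- The symmetric form puts Lebesgue measure first, the side on which local finiteness is already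
  -- known.
  refine (Real.measure_ext_Ioo_rat fun a b => ?_).symm
  rw [Measure.map_apply hr measurableSet_Ioo,
    Measure.restrict_apply (hr measurableSet_Ioo), Real.volume_Ioo,
    ← loebMeasure_stMap_preimage_Ioo hn]
  congr 1
  ext x
  simp only [Set.mem_preimage, Set.mem_inter_iff, Set.mem_Ioo, Set.mem_compl_iff,
    Set.mem_insert_iff, Set.mem_singleton_iff]
  -- At `±∞` the restriction is essential: `toReal` is 0 there, so the infinite points would
  -- otherwise pile up at 0.
  induction stMap _ _ x with
  | bot => simp
  | coe c => simp
  | top => simp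

/-! ### The Loeb integral by change of variables -/

theorem extendZero_eq_indicator (g : ℝ → ℂ) {α : Type*} (f : α → EReal) :
    (fun x => extendZero g (f x)) =
      (f ⁻¹' {⊤, ⊥}ᶜ).indicator (g ∘ fun x => (f x).toReal) := by
  ext x
  by_cases h : f x = ⊤ ∨ f x = ⊥ <;> simp [extendZero, Set.indicator, h]

theorem integral_extendZero_stMap {n : ι → ℕ} (hn : Tendsto n U atTop) {g : ℝ → ℂ}
    (hg : Integrable g) :
    Integrable (fun x : HyperInterval ((fun k => n k ^ 2 : ι → ℕ) : Ext U ℕ) (n : Ext U ℕ) =>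
      extendZero g (stMap _ _ x)) (loebMeasure _ _) ∧
    ∫ x : HyperInterval ((fun k => n k ^ 2 : ι → ℕ) : Ext U ℕ) (n : Ext U ℕ),
      extendZero g (stMap _ _ x) ∂(loebMeasure _ _) = ∫ t, g t := by
  have hm := measurable_stMap (N := fun k => n k ^ 2) hn
  have hr : Measurable fun x => (stMap ((fun k => n k ^ 2 : ι → ℕ) : Ext U ℕ) (n : Ext U ℕ) x).toReal :=
    measurable_ereal_toReal.comp hm
  have hF : MeasurableSet (stMap ((fun k => n k ^ 2 : ι → ℕ) : Ext U ℕ) (n : Ext U ℕ) ⁻¹' {⊤, ⊥}ᶜ) :=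
    hm (Set.Finite.measurableSet (by simp)).compl
  have hmap := map_toReal_stMap_loebMeasure hn
  rw [extendZero_eq_indicator g (stMap _ _), integrable_indicator_iff hF,
    integral_indicator hF]
  have hg' := hg
  rw [← hmap] at hg'
  refine ⟨(integrable_map_measure hg'.aestronglyMeasurable hr.aemeasurable).1 hg', ?_⟩
  rw [← hmap]
  exact (integral_map hr.aemeasurable hg'.aestronglyMeasurable).symm

end Loeb

end NSA

theorem mainTheorem3 {ι : Type*} (U : Ultrafilter ι) (η : NSA.Ext U ℕ)
    (hη : NSA.IsInfiniteNat η) (g : SchwartzMap ℝ ℂ) :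
    NSA.SIntegrable (η ^ 2) η (NSA.gridSample g η) ∧
    (∀ x : NSA.HyperInterval (η ^ 2) η,
      NSA.IsStdPart (NSA.evalAt (NSA.gridSample g η) x.1)
        (NSA.extendZero g (NSA.extStdPart x.1))) ∧
    Integrable (fun x : NSA.HyperInterval (η ^ 2) η => NSA.extendZero g (NSA.extStdPart x.1))
      (NSA.loebMeasure (η ^ 2) η) ∧
    NSA.IsStdPart (NSA.internalIntegral η (NSA.gridIndex (η ^ 2)) (NSA.gridSample g η))
      (∫ x : NSA.HyperInterval (η ^ 2) η, NSA.extendZero g (NSA.extStdPart x.1)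
        ∂(NSA.loebMeasure (η ^ 2) η)) ∧
    ∫ x : NSA.HyperInterval (η ^ 2) η, NSA.extendZero g (NSA.extStdPart x.1)
        ∂(NSA.loebMeasure (η ^ 2) η) = ∫ x : ℝ, g x := by
  induction η using Filter.Germ.inductionOn with
  | _ n =>
  have hn : Tendsto n U atTop := hη.tendsto
  obtain ⟨K, hK0, hK⟩ := NSA.exists_norm_le_sq_inv_one_add_sq g
  have hK1 : ∀ y, ‖g y‖ ≤ K ^ 2 * (1 + y ^ 2)⁻¹ := fun y => by
    refine (hK y).trans ?_
    rw [mul_pow, sq (1 + y ^ 2)⁻¹]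
    exact mul_le_mul_of_nonneg_left (mul_le_of_le_one_left (by positivity)
      (inv_le_one_of_one_le₀ (by nlinarith))) (sq_nonneg K)
  obtain ⟨h1, h2⟩ := NSA.integral_extendZero_stMap hn g.integrable
  refine ⟨NSA.sIntegrable_gridSample hn hK0 hK, fun x =>
    NSA.isStdPart_evalAt_gridSample hn g.continuous (zero_at_infty g) x.1, h1, ?_, h2⟩
  have h3 := NSA.isStdPart_internalIntegral_gridSample hn g.continuous hK1
  -- Both integrals equal `∫ g`, so the standard part can be restated as the Loeb integral.
  rw [← h2] at h3
  exact h3
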